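/- Let $R$ be a commutative Noetherian ring, $\mathfrak a$ an ideal of $R$, and $\mathcal S$ a Serre subcategory of the category of $R$-modules (a nonempty class of $R$-modules closed under submodules, quotients and extensions). For $i\ge 0$ let $H^i_{\mathfrak a}$ denote the $i$-th local cohomology functor, i.e. the $i$-th right derived functor of the $\mathfrak a$-torsion functor $\Gamma_{\mathfrak a}(M)=\{x\in M : \mathfrak a^k x=0 \text{ for some } k\ge 0\}$. An $R$-module $M$ is called $\mathfrak a$-torsion if $\Gamma_{\mathfrak a}(M)=M$, and $(\mathcal S,\mathfrak a)$-cofinite if $\operatorname{Supp}_R(M)\subseteq V(\mathfrak a)$ and $\operatorname{Ext}^i_R(R/\mathfrak a,M)\in\mathcal S$ for all $i\ge 0$. Let $N$ be a finitely generated $\mathfrak a$-torsion $R$-module, $X$ an arbitrary $R$-module, and $n$ a non-negative integer such that $\operatorname{Ext}^{n+1}_R(N,X)$ and $\operatorname{Ext}^{n+2}_R(N,X)$ are in $\mathcal S$, and $H^i_{\mathfrak a}(X)$ is $(\mathcal S,\mathfrak a)$-cofinite for all $i$ with $0\le i<n$. Then the following statements are equivalent: (i) $\operatorname{Hom}_R(N,H^{n+1}_{\mathfrak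 a}(X))\in\mathcal S$; (ii) $\operatorname{Ext}^2_R(N,H^n_{\mathfrak a}(X))\in\mathcal S$. -/

import Mathlib

open CategoryTheory

universe u

noncomputable section

namespace SerreCofinite

variable {R : Type u} [CommRing R]

/-- `Γ_𝔞(M)`: the submodule of all elements of `M` annihilated by some power of the ideal `𝔞`. -/
def Gamma (𝔞 : Ideal R) (M : Type u) [AddCommGroup M] [Module R M] : Submodule R M where
  carrier := {x | ∃ k : ℕ, ∀ r ∈ 𝔞 ^ k, r • x = 0}
  zero_mem' := ⟨0, fun r _ => smul_zero r⟩
  add_mem' := by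
    rintro x y ⟨k, hk⟩ ⟨l, hl⟩
    refine ⟨k + l, fun r hr => ?_⟩
    rw [smul_add, hk r (Ideal.pow_le_pow_right (Nat.le_add_right k l) hr),
      hl r (Ideal.pow_le_pow_right (Nat.le_add_left l k) hr), add_zero]
  smul_mem' := by
    rintro c x ⟨k, hk⟩
    exact ⟨k, fun r hr => by rw [smul_comm, hk r hr, smul_zero]⟩

theorem mem_Gamma {𝔞 : Ideal R} {M : Type u} [AddCommGroup M] [Module R M] {x : M} :
    x ∈ Gamma 𝔞 M ↔ ∃ k : ℕ, ∀ r ∈ 𝔞 ^ k, r • x = 0 :=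
  Iff.rfl

theorem map_mem_Gamma (𝔞 : Ideal R) {M M' : Type u} [AddCommGroup M] [Module R M]
    [AddCommGroup M'] [Module R M'] (f : M →ₗ[R] M') (x : M) (hx : x ∈ Gamma 𝔞 M) :
    f x ∈ Gamma 𝔞 M' := by
  obtain ⟨k, hk⟩ := hx
  exact ⟨k, fun r hr => by rw [← map_smul, hk r hr, map_zero]⟩

/-- `M` is `𝔞`-torsion: `Γ_𝔞(M) = M`. -/
def IsIdealTorsion (𝔞 : Ideal R) (M : Type u) [AddCommGroup M] [Module R M] : Prop :=
  Gamma 𝔞 M = ⊤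

/-- The `𝔞`-torsion functor `Γ_𝔞`; it sends `f : M ⟶ M'` to its restriction
`Γ_𝔞(M) ⟶ Γ_𝔞(M')`. -/
def gammaFunctor (𝔞 : Ideal R) : ModuleCat.{u} R ⥤ ModuleCat.{u} R where
  obj M := ModuleCat.of R (Gamma 𝔞 M)
  map f := ModuleCat.ofHom (f.hom.restrict (map_mem_Gamma 𝔞 f.hom))

instance gammaFunctor_additive (𝔞 : Ideal R) : (gammaFunctor 𝔞).Additive where
  map_add := rfl

/-- The `i`-th local cohomology module `H^i_𝔞(X)`: the value at `X` of the `i`-th right derived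
functor of the `𝔞`-torsion functor `Γ_𝔞`. -/
def localCohom (𝔞 : Ideal R) (i : ℕ) (X : ModuleCat.{u} R) : ModuleCat.{u} R :=
  ((gammaFunctor 𝔞).rightDerived i).obj X

/-- The `R`-module `Ext^i_R(M, X)`. -/
abbrev extModule (M X : ModuleCat.{u} R) (i : ℕ) : ModuleCat.{u} R :=
  ModuleCat.of R (Abelian.Ext M X i)

/-- `X` is `(𝒮, 𝔞)`-cofinite: `Supp_R(X) ⊆ V(𝔞)` and `Ext^i_R(R/𝔞, X) ∈ 𝒮` for all `i ≥ 0`. -/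
def IsCofinite (S : ObjectProperty (ModuleCat.{u} R)) (𝔞 : Ideal R) (X : ModuleCat.{u} R) :
    Prop :=
  Module.support R X ⊆ PrimeSpectrum.zeroLocus (𝔞 : Set R) ∧
    ∀ i : ℕ, S (extModule (ModuleCat.of R (R ⧸ 𝔞)) X i)

end SerreCofinite

end

/-! Take an injective resolution `I` of `X`, and let `Z`, `B` be the cocycles and coboundaries of
`Γ_𝔞(I)`, whose terms are again injective (`injective_Gamma`, via Artin–Rees). Both conditions
amount to `Ext¹(N, Bⁿ⁺¹) ∈ 𝒮`. For (ii): `0 → Zⁿ → Γ_𝔞(Iⁿ) → Bⁿ⁺¹ → 0` shifts this to `Ext²(N, Zⁿ)`.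
Cofiniteness of `H^i` for `i < n` passes from `R/𝔞` to `N` by dévissage
(`prop_ext_of_isIdealTorsion`) and puts the positive Exts of `Bⁿ` in `𝒮`, so `Zⁿ` may be replaced by
`Hⁿ`. For (i): in `Hom(N, Zⁿ⁺¹) → Hom(N, Hⁿ⁺¹) → Ext¹(N, Bⁿ⁺¹) → Ext¹(N, Zⁿ⁺¹)` the image of the
first map is controlled by `Extⁿ⁺¹(N, X)` and the last term by `Extⁿ⁺²(N, X)`. Both bounds compare
`Γ_𝔞(I)` with `I`, using that maps from the torsion module `N` land in torsion. -/

namespace SerreCofinite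

open Abelian

variable {R : Type u} [CommRing R]

/-! ### Serre classes and long exact Ext sequences -/

section SerreClass

variable (S : ObjectProperty (ModuleCat.{u} R)) [S.IsSerreClass]

theorem prop_of_linearEquiv {A B : ModuleCat.{u} R} (e : A ≃ₗ[R] B) (hA : S A) : S B :=
  S.prop_of_iso e.toModuleIso hA

theorem prop_of_injective {A B : ModuleCat.{u} R} (f : A →ₗ[R] B) (hf : Function.Injective f)
    (hB : S B) : S A :=
  have : Mono (ModuleCat.ofHom f) := (ModuleCat.mono_iff_injective _).2 hf
  S.prop_of_mono (ModuleCat.ofHom f) hB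

theorem prop_of_surjective {A B : ModuleCat.{u} R} (f : A →ₗ[R] B) (hf : Function.Surjective f)
    (hA : S A) : S B :=
  have : Epi (ModuleCat.ofHom f) := (ModuleCat.epi_iff_surjective _).2 hf
  S.prop_of_epi (ModuleCat.ofHom f) hA

theorem prop_of_exact {A B C : ModuleCat.{u} R} (f : A →ₗ[R] B) (g : B →ₗ[R] C)
    (h : Function.Exact f g) (hA : S A) (hC : S C) : S B :=
  S.prop_X₂_of_exact (S := ModuleCat.shortComplexOfCompEqZero f g h.linearMap_comp_eq_zero)
    (ModuleCat.shortComplex_exact _ h) hA hC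

theorem prop_of_subsingleton (A : ModuleCat.{u} R) [Subsingleton A] : S A :=
  S.prop_of_isZero (ModuleCat.isZero_of_subsingleton A)

/-- If `f : P → A` with `A ∈ 𝒮` and `g : P → B` kills the kernel of `f`, then the image of `g`
lies in `𝒮`. -/
theorem prop_range_of_ker_le {P A B : ModuleCat.{u} R} (f : P →ₗ[R] A) (g : P →ₗ[R] B)
    (h : LinearMap.ker f ≤ LinearMap.ker g) (hA : S A) :
    S (ModuleCat.of R (LinearMap.range g)) := by
  have h₁ : S (ModuleCat.of R (P ⧸ LinearMap.ker f)) :=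
    prop_of_injective S (B := A) ((LinearMap.ker f).liftQ f le_rfl)
      (LinearMap.ker_eq_bot.1 (Submodule.ker_liftQ_eq_bot _ _ _ le_rfl)) hA
  refine prop_of_surjective S (A := ModuleCat.of R (P ⧸ LinearMap.ker f))
    (B := ModuleCat.of R (LinearMap.range g))
    ((LinearMap.ker f).liftQ g.rangeRestrict (by rwa [LinearMap.ker_rangeRestrict])) ?_ h₁
  rintro ⟨_, x, rfl⟩
  exact ⟨Submodule.Quotient.mk x, rfl⟩

theorem prop_hom_iff (N M : ModuleCat.{u} R) :
    S (ModuleCat.of R (N →ₗ[R] M)) ↔ S (extModule N M 0) :=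
  let e : Ext N M 0 ≃ₗ[R] (N →ₗ[R] M) := Ext.linearEquiv₀.trans ModuleCat.homLinearEquiv
  ⟨prop_of_linearEquiv S (A := ModuleCat.of R (N →ₗ[R] M)) (B := extModule N M 0) e.symm,
    prop_of_linearEquiv S (A := extModule N M 0) (B := ModuleCat.of R (N →ₗ[R] M)) e⟩

theorem prop_ext_of_injective (N E : ModuleCat.{u} R) [Injective E] (p : ℕ) :
    S (extModule N E (p + 1)) :=
  have : Subsingleton (Ext N E (p + 1)) := Ext.subsingleton_of_injective N E p
  prop_of_subsingleton S (extModule N E (p + 1))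

section Covariant

variable {T : ShortComplex (ModuleCat.{u} R)} (hT : T.ShortExact) (N : ModuleCat.{u} R)

include hT

theorem prop_ext_middle {p : ℕ} (h₁ : S (extModule N T.X₁ p)) (h₃ : S (extModule N T.X₃ p)) :
    S (extModule N T.X₂ p) := by
  refine prop_of_exact S (A := extModule N T.X₁ p) (B := extModule N T.X₂ p)
    (C := extModule N T.X₃ p) ((Ext.mk₀ T.f).postcompOfLinear R N (add_zero p))
    ((Ext.mk₀ T.g).postcompOfLinear R N (add_zero p)) (fun x => ⟨fun hx => ?_, ?_⟩) h₁ h₃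
  · exact Ext.covariant_sequence_exact₂ N hT x hx
  · rintro ⟨y, rfl⟩
    simp [Ext.mk₀_comp_mk₀]

theorem prop_ext_right {p : ℕ} (h₂ : S (extModule N T.X₂ p))
    (h₁ : S (extModule N T.X₁ (p + 1))) : S (extModule N T.X₃ p) := by
  refine prop_of_exact S (A := extModule N T.X₂ p) (B := extModule N T.X₃ p)
    (C := extModule N T.X₁ (p + 1)) ((Ext.mk₀ T.g).postcompOfLinear R N (add_zero p))
    (hT.extClass.postcompOfLinear R N rfl) (fun x => ⟨fun hx => ?_, ?_⟩) h₂ h₁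
  · exact Ext.covariant_sequence_exact₃ N hT x rfl hx
  · rintro ⟨y, rfl⟩
    simp

theorem prop_ext_left {p : ℕ} (h₃ : S (extModule N T.X₃ p))
    (h₂ : S (extModule N T.X₂ (p + 1))) : S (extModule N T.X₁ (p + 1)) := by
  refine prop_of_exact S (A := extModule N T.X₃ p) (B := extModule N T.X₁ (p + 1))
    (C := extModule N T.X₂ (p + 1)) (hT.extClass.postcompOfLinear R N rfl)
    ((Ext.mk₀ T.f).postcompOfLinear R N (add_zero (p + 1))) (fun x => ⟨fun hx => ?_, ?_⟩) h₃ h₂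
  · exact Ext.covariant_sequence_exact₁ N hT x hx rfl
  · rintro ⟨y, rfl⟩
    simp

/-- Dimension shift; the degree on `T.X₃` must be positive for both neighbouring Exts of `T.X₂` to
vanish. -/
theorem prop_ext_iff_of_injective_middle [Injective T.X₂] (p : ℕ) :
    S (extModule N T.X₃ (p + 1)) ↔ S (extModule N T.X₁ (p + 2)) :=
  ⟨fun h => prop_ext_left S hT N h (prop_ext_of_injective S N T.X₂ (p + 1)),
    fun h => prop_ext_right S hT N (prop_ext_of_injective S N T.X₂ p) h⟩

end Covariant

section Contravariant

variable {T : ShortComplex (ModuleCat.{u} R)} (hT : T.ShortExact) (M : ModuleCat.{u} R)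

include hT

theorem prop_ext_contra_middle {p : ℕ} (h₁ : S (extModule T.X₁ M p))
    (h₃ : S (extModule T.X₃ M p)) : S (extModule T.X₂ M p) := by
  refine prop_of_exact S (A := extModule T.X₃ M p) (B := extModule T.X₂ M p)
    (C := extModule T.X₁ M p) ((Ext.mk₀ T.g).precompOfLinear R M (zero_add p))
    ((Ext.mk₀ T.f).precompOfLinear R M (zero_add p)) (fun x => ⟨fun hx => ?_, ?_⟩) h₃ h₁
  · exact Ext.contravariant_sequence_exact₂ hT M x hx
  · rintro ⟨y, rfl⟩
    simp

theorem prop_ext_contra_right_zero (h₂ : S (extModule T.X₂ M 0)) : S (extModule T.X₃ M 0) :=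
  have := hT.epi_g
  prop_of_injective S (A := extModule T.X₃ M 0) (B := extModule T.X₂ M 0)
    ((Ext.mk₀ T.g).precompOfLinear R M (zero_add 0)) (Ext.precomp_mk₀_injective_of_epi M T.g) h₂

theorem prop_ext_contra_right_succ {p : ℕ} (h₁ : S (extModule T.X₁ M p))
    (h₂ : S (extModule T.X₂ M (p + 1))) : S (extModule T.X₃ M (p + 1)) := by
  refine prop_of_exact S (A := extModule T.X₁ M p) (B := extModule T.X₃ M (p + 1))
    (C := extModule T.X₂ M (p + 1)) (hT.extClass.precompOfLinear R M (add_comm 1 p))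
    ((Ext.mk₀ T.g).precompOfLinear R M (zero_add (p + 1))) (fun x => ⟨fun hx => ?_, ?_⟩) h₁ h₂
  · exact Ext.contravariant_sequence_exact₃ hT M x hx (add_comm 1 p)
  · rintro ⟨y, rfl⟩
    simp

end Contravariant

theorem prop_ext_congr_left {N N' : ModuleCat.{u} R} (e : N ≅ N') (M : ModuleCat.{u} R)
    {p : ℕ} (h : S (extModule N' M p)) : S (extModule N M p) := by
  refine prop_of_injective S (A := extModule N M p) (B := extModule N' M p)
    ((Ext.mk₀ e.inv).precompOfLinear R M (zero_add p)) (fun x y hxy => ?_) h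
  have := congrArg ((Ext.mk₀ e.hom).precompOfLinear R M (zero_add p)) hxy
  simpa using this

theorem prop_ext_congr_right (N : ModuleCat.{u} R) {M M' : ModuleCat.{u} R} (e : M ≅ M')
    {p : ℕ} (h : S (extModule N M p)) : S (extModule N M' p) := by
  refine prop_of_injective S (A := extModule N M' p) (B := extModule N M p)
    ((Ext.mk₀ e.inv).postcompOfLinear R N (add_zero p)) (fun x y hxy => ?_) h
  have := congrArg ((Ext.mk₀ e.hom).postcompOfLinear R N (add_zero p)) hxy
  simpa using this

end SerreClass

/-! ### Torsion modules and torsion in injectives -/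

section Torsion

variable {𝔞 : Ideal R}

theorem IsIdealTorsion.mem {M : Type u} [AddCommGroup M] [Module R M]
    (h : IsIdealTorsion 𝔞 M) (x : M) : x ∈ Gamma 𝔞 M :=
  (h : Gamma 𝔞 M = ⊤) ▸ Submodule.mem_top

theorem IsIdealTorsion.of_surjective {M M' : Type u} [AddCommGroup M] [Module R M]
    [AddCommGroup M'] [Module R M'] (h : IsIdealTorsion 𝔞 M) (f : M →ₗ[R] M')
    (hf : Function.Surjective f) : IsIdealTorsion 𝔞 M' := by
  refine eq_top_iff.2 fun y _ => ?_
  obtain ⟨x, rfl⟩ := hf y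
  exact map_mem_Gamma 𝔞 f x (h.mem x)

theorem IsIdealTorsion.of_injective {M M' : Type u} [AddCommGroup M] [Module R M]
    [AddCommGroup M'] [Module R M'] (h : IsIdealTorsion 𝔞 M') (f : M →ₗ[R] M')
    (hf : Function.Injective f) : IsIdealTorsion 𝔞 M := by
  refine eq_top_iff.2 fun x _ => ?_
  obtain ⟨k, hk⟩ := h.mem (f x)
  exact ⟨k, fun r hr => hf (by rw [map_smul, hk r hr, map_zero])⟩

theorem isIdealTorsion_quotient_self : IsIdealTorsion 𝔞 (R ⧸ 𝔞) := by
  refine eq_top_iff.2 fun x _ => ⟨1, fun r hr => ?_⟩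
  obtain ⟨y, rfl⟩ := Ideal.Quotient.mk_surjective x
  rw [pow_one] at hr
  rw [Algebra.smul_def, Ideal.Quotient.algebraMap_eq, Ideal.Quotient.eq_zero_iff_mem.2 hr,
    zero_mul]

theorem le_of_isIdealTorsion_quotient {p : Ideal R} (hp : p.IsPrime)
    (h : IsIdealTorsion 𝔞 (R ⧸ p)) : 𝔞 ≤ p := by
  obtain ⟨k, hk⟩ := h.mem 1
  refine hp.le_of_pow_le (n := k) fun r hr => ?_
  have := hk r hr
  rwa [Algebra.smul_def, mul_one, Ideal.Quotient.algebraMap_eq,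
    Ideal.Quotient.eq_zero_iff_mem] at this

/-- An element is `𝔞`-torsion as soon as a finitely generated power `𝔞 ^ k` maps it into the
`𝔞`-torsion submodule. -/
theorem mem_Gamma_of_pow_smul_mem [IsNoetherianRing R] {M : Type u} [AddCommGroup M] [Module R M]
    {x : M} {k : ℕ} (h : ∀ r ∈ 𝔞 ^ k, r • x ∈ Gamma 𝔞 M) : x ∈ Gamma 𝔞 M := by
  -- Finite generation of `J` makes the annihilating exponent uniform.
  have key : ∀ J : Ideal R, J.FG → (∀ r ∈ J, r • x ∈ Gamma 𝔞 M) →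
      ∃ l : ℕ, ∀ s ∈ 𝔞 ^ l, ∀ r ∈ J, s • r • x = 0 := by
    intro J hJ
    induction J, hJ using Submodule.fg_induction with
    | singleton a =>
      intro hr
      obtain ⟨l, hl⟩ := hr a (Submodule.mem_span_singleton_self a)
      refine ⟨l, fun s hs r hr => ?_⟩
      obtain ⟨c, rfl⟩ := Submodule.mem_span_singleton.1 hr
      rw [smul_assoc, smul_comm, hl s hs, smul_zero]
    | sup J₁ J₂ _ _ h₁ h₂ =>
      intro hr
      obtain ⟨l₁, hl₁⟩ := h₁ fun r h => hr r (Submodule.mem_sup_left h)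
      obtain ⟨l₂, hl₂⟩ := h₂ fun r h => hr r (Submodule.mem_sup_right h)
      refine ⟨l₁ + l₂, fun s hs r hr => ?_⟩
      obtain ⟨a, ha, b, hb, rfl⟩ := Submodule.mem_sup.1 hr
      rw [add_smul, smul_add, hl₁ s (Ideal.pow_le_pow_right (Nat.le_add_right _ _) hs) a ha,
        hl₂ s (Ideal.pow_le_pow_right (Nat.le_add_left _ _) hs) b hb, add_zero]
  obtain ⟨l, hl⟩ := key (𝔞 ^ k) (IsNoetherian.noetherian _) h
  refine ⟨l + k, fun r hr => ?_⟩
  rw [pow_add] at hr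
  refine Submodule.mul_induction_on hr (fun s hs r hr => ?_) fun a b ha hb => ?_
  · rw [mul_smul, hl s hs r hr]
  · rw [add_smul, ha, hb, add_zero]

/-- There are no nonzero maps from an `𝔞`-torsion module to a quotient by a submodule containing
the `𝔞`-torsion. -/
theorem eq_zero_of_isIdealTorsion [IsNoetherianRing R] {N A B C : Type u}
    [AddCommGroup N] [Module R N] [AddCommGroup A] [Module R A] [AddCommGroup B] [Module R B]
    [AddCommGroup C] [Module R C] (hN : IsIdealTorsion 𝔞 N) (hA : IsIdealTorsion 𝔞 A)
    {f : A →ₗ[R] B} {g : B →ₗ[R] C} (hfg : Function.Exact f g) (hg : Function.Surjective g)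
    (hB : ∀ b ∈ Gamma 𝔞 B, g b = 0) (φ : N →ₗ[R] C) : φ = 0 := by
  ext x
  obtain ⟨b, hb⟩ := hg (φ x)
  obtain ⟨k, hk⟩ := hN.mem x
  rw [← hb, LinearMap.zero_apply]
  -- The lift `b` is itself torsion: `𝔞 ^ k` moves it into the image of the torsion module `A`.
  refine hB b (mem_Gamma_of_pow_smul_mem (k := k) fun r hr => ?_)
  obtain ⟨a, ha⟩ := (hfg (r • b)).1 (by rw [map_smul, hb, ← map_smul, hk r hr, map_zero])
  exact ha ▸ map_mem_Gamma 𝔞 f a (hA.mem a)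

theorem exists_pow_smul_eq_zero_of_fg {M : Type u} [AddCommGroup M] [Module R M]
    (P : Submodule R M) (hP : P.FG) (h : P ≤ Gamma 𝔞 M) :
    ∃ k : ℕ, ∀ r ∈ 𝔞 ^ k, ∀ x ∈ P, r • x = 0 := by
  induction P, hP using Submodule.fg_induction with
  | singleton a =>
    obtain ⟨k, hk⟩ := h (Submodule.mem_span_singleton_self a)
    refine ⟨k, fun r hr x hx => ?_⟩
    obtain ⟨c, rfl⟩ := Submodule.mem_span_singleton.1 hx
    rw [smul_comm, hk r hr, smul_zero]
  | sup P₁ P₂ _ _ h₁ h₂ =>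
    obtain ⟨k₁, hk₁⟩ := h₁ (le_sup_left.trans h)
    obtain ⟨k₂, hk₂⟩ := h₂ (le_sup_right.trans h)
    refine ⟨k₁ + k₂, fun r hr x hx => ?_⟩
    obtain ⟨a, ha, b, hb, rfl⟩ := Submodule.mem_sup.1 hx
    rw [smul_add, hk₁ r (Ideal.pow_le_pow_right (Nat.le_add_right _ _) hr) a ha,
      hk₂ r (Ideal.pow_le_pow_right (Nat.le_add_left _ _) hr) b hb, add_zero]

/-- Over a Noetherian ring, the `𝔞`-torsion submodule of an injective module is injective. -/
theorem injective_Gamma [IsNoetherianRing R] (𝔞 : Ideal R) (E : Type u) [AddCommGroup E]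
    [Module R E] [Module.Injective R E] : Module.Injective R (Gamma 𝔞 E) := by
  refine Module.Baer.injective fun I f => ?_
  obtain ⟨k, hk⟩ := exists_pow_smul_eq_zero_of_fg (LinearMap.range ((Gamma 𝔞 E).subtype ∘ₗ f))
    (Submodule.map_top ((Gamma 𝔞 E).subtype ∘ₗ f) ▸ (IsNoetherian.noetherian ⊤).map _)
    (by rintro _ ⟨x, rfl⟩; exact (f x).2)
  -- Artin–Rees: `𝔞 ^ (k + c) ∩ I ⊆ 𝔞 ^ k I`, and `f` kills the latter.
  obtain ⟨c, hc⟩ := Ideal.exists_pow_inf_eq_pow_smul 𝔞 (M := R) I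
  have hker : ∀ x : I, (x : R) ∈ 𝔞 ^ (k + c) → f x = 0 := by
    intro x hx
    have hx' : (x : R) ∈ 𝔞 ^ k • I := by
      have h₁ := hc (k + c) (Nat.le_add_left _ _)
      rw [Nat.add_sub_cancel] at h₁
      have h₂ : (x : R) ∈ 𝔞 ^ (k + c) • (⊤ : Submodule R R) ⊓ I :=
        ⟨by simpa using hx, x.2⟩
      rw [h₁] at h₂
      exact Submodule.smul_mono le_rfl inf_le_right h₂
    have key : ∀ y ∈ 𝔞 ^ k • I, ∃ hy : y ∈ I, f ⟨y, hy⟩ = 0 := by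
      intro y hy
      refine Submodule.smul_induction_on hy (fun r hr z hz => ?_) ?_
      · refine ⟨I.smul_mem r hz, Subtype.ext ?_⟩
        exact (congrArg Subtype.val (map_smul f r ⟨z, hz⟩)).trans (hk r hr _ ⟨⟨z, hz⟩, rfl⟩)
      · rintro y z ⟨hy, hfy⟩ ⟨hz, hfz⟩
        refine ⟨I.add_mem hy hz, ?_⟩
        exact (map_add f ⟨y, hy⟩ ⟨z, hz⟩).trans (by rw [hfy, hfz, add_zero])
    exact (key x hx').2
  -- So `f` factors through the image of `I` in `R ⧸ 𝔞 ^ (k + c)`; any extension of it to that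
  -- quotient has torsion values.
  let q : I →ₗ[R] R ⧸ 𝔞 ^ (k + c) := (Submodule.mkQ (𝔞 ^ (k + c))) ∘ₗ I.subtype
  have hq : LinearMap.ker q ≤ LinearMap.ker ((Gamma 𝔞 E).subtype ∘ₗ f) := by
    intro x hx
    have hx' : f x = 0 := hker x ((Submodule.Quotient.mk_eq_zero _).1 hx)
    exact LinearMap.mem_ker.2 (by rw [LinearMap.comp_apply, hx', map_zero])
  obtain ⟨h, hh⟩ := Module.Injective.out ((LinearMap.ker q).liftQ q le_rfl)
    (LinearMap.ker_eq_bot.1 (Submodule.ker_liftQ_eq_bot _ _ _ le_rfl))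
    ((LinearMap.ker q).liftQ ((Gamma 𝔞 E).subtype ∘ₗ f) hq)
  have hmem : ∀ x : R, h (Submodule.Quotient.mk x) ∈ Gamma 𝔞 E := fun x =>
    ⟨k + c, fun r hr => by
      rw [← map_smul, ← Submodule.Quotient.mk_smul,
        smul_eq_mul,
        (Submodule.Quotient.mk_eq_zero _).2 (Ideal.mul_mem_right x _ hr), map_zero]⟩
  exact ⟨(h ∘ₗ Submodule.mkQ (𝔞 ^ (k + c))).codRestrict _ hmem,
    fun x hx => Subtype.ext (hh (Submodule.Quotient.mk ⟨x, hx⟩))⟩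

end Torsion

/-- If `Ext^i_R(R/𝔞, M) ∈ 𝒮` for all `i`, then `Ext^i_R(N, M) ∈ 𝒮` for all finitely generated
`𝔞`-torsion modules `N`. -/
theorem prop_ext_of_isIdealTorsion [IsNoetherianRing R] {𝔞 : Ideal R}
    (S : ObjectProperty (ModuleCat.{u} R)) [S.IsSerreClass] (M : ModuleCat.{u} R)
    (hM : ∀ i, S (extModule (ModuleCat.of R (R ⧸ 𝔞)) M i)) (i : ℕ) (N : ModuleCat.{u} R)
    [Module.Finite R N] (hN : IsIdealTorsion 𝔞 N) : S (extModule N M i) := by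
  induction i using Nat.strong_induction_on generalizing N with
  | _ i ih =>
    suffices H : ∀ (L : Type u) [AddCommGroup L] [Module R L] [Module.Finite R L],
        IsIdealTorsion 𝔞 L → S (extModule (ModuleCat.of R L) M i) from H N hN
    intro L _ _ _ hL
    refine IsNoetherianRing.induction_on_isQuotientEquivQuotientPrime R ‹_›
      (motive := fun L _ _ _ => IsIdealTorsion 𝔞 L → S (extModule (ModuleCat.of R L) M i))
      ?_ ?_ ?_ hL
    · intro L _ _ _ _ _
      have hz : Limits.IsZero (ModuleCat.of R L) := ModuleCat.isZero_of_subsingleton _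
      have : Subsingleton (Ext (ModuleCat.of R L) M i) := by
        refine subsingleton_of_forall_eq 0 fun x => ?_
        rw [← Ext.mk₀_id_comp x, hz.eq_of_src (𝟙 _) 0, Ext.mk₀_zero, Ext.zero_comp]
      exact prop_of_subsingleton S (extModule (ModuleCat.of R L) M i)
    · intro L _ _ _ p e hL
      refine prop_ext_congr_left S (N' := ModuleCat.of R (R ⧸ p.1)) e.toModuleIso M ?_
      have hp : 𝔞 ≤ p.1 := le_of_isIdealTorsion_quotient p.2
        (hL.of_surjective e.toLinearMap e.surjective)
      let g : (R ⧸ 𝔞) →ₗ[R] R ⧸ p.1 := Submodule.factor hp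
      -- The kernel of `R/𝔞 → R/p` is finitely generated and torsion, so the induction on degree
      -- covers its `Ext` one degree lower.
      have hT := LinearMap.shortExact_shortComplexKer (f := g) (Submodule.factor_surjective hp)
      rcases i with _ | i
      · exact prop_ext_contra_right_zero S hT M (hM 0)
      · exact prop_ext_contra_right_succ S hT M
          (ih i i.lt_succ_self (ModuleCat.of R (LinearMap.ker g))
            (isIdealTorsion_quotient_self.of_injective (LinearMap.ker g).subtype
              (LinearMap.ker g).injective_subtype)) (hM (i + 1))
    · intro L₁ _ _ _ L₂ _ _ _ L₃ _ _ _ f g hf hg hfg h₁ h₃ h₂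
      exact prop_ext_contra_middle S (ModuleCat.shortComplex_shortExact
        (ModuleCat.shortComplexOfCompEqZero f g hfg.linearMap_comp_eq_zero) hfg hf hg) M
        (h₁ (h₂.of_injective f hf)) (h₃ (h₂.of_surjective g hg))

theorem exists_ker_to_homology (T : ShortComplex (ModuleCat.{u} R)) :
    ∃ π : LinearMap.ker T.g.hom →ₗ[R] T.homology, Function.Surjective π ∧
      ∀ z, π z = 0 ↔ z.1 ∈ LinearMap.range T.f.hom := by
  let e : T.homology ≃ₗ[R] LinearMap.ker T.g.hom ⧸ LinearMap.range T.moduleCatToCycles :=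
    T.moduleCatHomologyIso.toLinearEquiv
  refine ⟨e.symm.toLinearMap ∘ₗ (LinearMap.range T.moduleCatToCycles).mkQ,
    e.symm.surjective.comp (Submodule.mkQ_surjective _), fun z => ?_⟩
  rw [LinearMap.comp_apply, LinearEquiv.coe_coe, LinearEquiv.map_eq_zero_iff,
    Submodule.mkQ_apply, Submodule.Quotient.mk_eq_zero]
  constructor
  · rintro ⟨x, rfl⟩
    exact ⟨x, rfl⟩
  · rintro ⟨x, hx⟩
    exact ⟨x, Subtype.ext hx⟩

/-! ### Cocycles, coboundaries and homology -/

section Complex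

variable (K : CochainComplex (ModuleCat.{u} R) ℕ)

/-- The submodule of `n`-cocycles. -/
abbrev cocycles (n : ℕ) : Submodule R (K.X n) := LinearMap.ker (K.d n (n + 1)).hom

/-- The submodule of `n`-coboundaries; for `n = 0` the differential `K.d (n - 1) n` vanishes. -/
abbrev coboundaries (n : ℕ) : Submodule R (K.X n) := LinearMap.range (K.d (n - 1) n).hom

theorem coboundaries_zero : coboundaries K 0 = ⊥ := by
  rw [coboundaries, K.shape _ _ (by simp)]
  exact LinearMap.range_zero

theorem coboundaries_le_cocycles (n : ℕ) : coboundaries K n ≤ cocycles K n := by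
  rintro _ ⟨x, rfl⟩
  exact congrArg (fun f => f.hom x) (K.d_comp_d (n - 1) n (n + 1))

/-- `0 → Zⁿ → Kⁿ → Bⁿ⁺¹ → 0`. -/
theorem exists_shortExact_cocycles (n : ℕ) :
    ∃ T : ShortComplex (ModuleCat.{u} R), T.ShortExact ∧
      T.X₁ = ModuleCat.of R (cocycles K n) ∧ T.X₂ = K.X n ∧
      T.X₃ = ModuleCat.of R (coboundaries K (n + 1)) := by
  -- The kernel of `rangeRestrict` is the cocycle module only up to a propositional equality, hence
  -- the equations in the statement.
  refine ⟨(K.d n (n + 1)).hom.rangeRestrict.shortComplexKer,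
    LinearMap.shortExact_shortComplexKer (LinearMap.surjective_rangeRestrict _),
    congrArg (fun P : Submodule R (K.X n) => ModuleCat.of R P) (LinearMap.ker_rangeRestrict _),
    rfl, rfl⟩

/-- The projection of cocycles onto cohomology, with kernel the coboundaries. -/
theorem exists_cocycles_to_homology (n : ℕ) :
    ∃ π : cocycles K n →ₗ[R] K.homology n, Function.Surjective π ∧
      ∀ z, π z = 0 ↔ z.1 ∈ coboundaries K n := by
  obtain ⟨π, hπ, h⟩ := exists_ker_to_homology (K.sc' (n - 1) n (n + 1))
  let e : (K.sc' (n - 1) n (n + 1)).homology ≃ₗ[R] K.homology n :=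
    (ShortComplex.homologyMapIso
      (K.isoSc' (n - 1) n (n + 1) (by cases n <;> simp) (by simp))).symm.toLinearEquiv
  exact ⟨e.toLinearMap ∘ₗ π, e.surjective.comp hπ, fun z => e.map_eq_zero_iff.trans (h z)⟩

end Complex

/-! ### Comparing `Γ_𝔞(I)` with `I` -/

section Resolution

variable (𝔞 : Ideal R) {X : ModuleCat.{u} R} (I : InjectiveResolution X)

/-- The complex of `𝔞`-torsion submodules of an injective resolution. -/
abbrev gammaComplex : CochainComplex (ModuleCat.{u} R) ℕ :=
  ((gammaFunctor 𝔞).mapHomologicalComplex _).obj I.cocomplex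

instance injective_gammaComplex [IsNoetherianRing R] (n : ℕ) :
    Injective ((gammaComplex 𝔞 I).X n) := by
  have : Module.Injective R (I.cocomplex.X n) :=
    (Module.injective_iff_injective_object R (I.cocomplex.X n)).2 (I.injective n)
  have := injective_Gamma 𝔞 (I.cocomplex.X n)
  exact Module.injective_object_of_injective_module R (Gamma 𝔞 (I.cocomplex.X n))

theorem isIdealTorsion_gammaComplex (n : ℕ) : IsIdealTorsion 𝔞 ((gammaComplex 𝔞 I).X n) := by
  refine eq_top_iff.2 fun x _ => ?_
  obtain ⟨k, hk⟩ := x.2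
  exact ⟨k, fun r hr => Subtype.ext (hk r hr)⟩

/-- The inclusion of the cocycles of `Γ_𝔞(I)` into those of `I`. -/
def gammaCocyclesInclusion (n : ℕ) :
    cocycles (gammaComplex 𝔞 I) n →ₗ[R] cocycles I.cocomplex n :=
  LinearMap.restrict (Gamma 𝔞 (I.cocomplex.X n)).subtype fun _ hx => congrArg Subtype.val hx

theorem gammaCocyclesInclusion_injective (n : ℕ) :
    Function.Injective (gammaCocyclesInclusion 𝔞 I n) := fun _ _ h =>
  Subtype.ext (Subtype.ext (congrArg (fun z : cocycles I.cocomplex n => z.1) h))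

theorem cocycles_succ_eq_coboundaries (n : ℕ) :
    coboundaries I.cocomplex (n + 1) = cocycles I.cocomplex (n + 1) :=
  (I.exact_succ n).moduleCat_range_eq_ker

/-- The augmentation identifies `X` with the `0`-cocycles of its injective resolution. -/
theorem nonempty_iso_cocycles_zero :
    Nonempty (X ≅ ModuleCat.of R (cocycles I.cocomplex 0)) :=
  ⟨I.isLimitKernelFork.conePointUniqueUpToIso (ModuleCat.kernelIsLimit (I.cocomplex.d 0 1))⟩

variable (S : ObjectProperty (ModuleCat.{u} R)) [S.IsSerreClass]

/-- The `m`-cocycles of `I` form an `m`-th cosyzygy of `X`, so each dimension shift trades one step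
of `m` for one degree of `Ext`. -/
theorem prop_ext_cocycles (N : ModuleCat.{u} R) (p m : ℕ)
    (h : S (extModule N X (m + p + 1))) :
    S (extModule N (ModuleCat.of R (cocycles I.cocomplex m)) (p + 1)) := by
  induction m generalizing p with
  | zero =>
    rw [Nat.zero_add] at h
    exact prop_ext_congr_right S N (nonempty_iso_cocycles_zero I).some h
  | succ m ih =>
    obtain ⟨T, hT, h₁, h₂, h₃⟩ := exists_shortExact_cocycles I.cocomplex m
    have : Injective T.X₂ := h₂ ▸ I.injective m
    rw [← cocycles_succ_eq_coboundaries, ← h₃, prop_ext_iff_of_injective_middle S hT, h₁]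
    exact ih (p + 1) (by rwa [show m + (p + 1) + 1 = m + 1 + p + 1 by omega])

variable {𝔞} in
-- The cocycles of `Γ_𝔞(I)` are exactly the torsion part of those of `I`, so `N` has no nonzero map
-- to the quotient and `Ext¹` injects.
theorem prop_ext_gammaCocycles [IsNoetherianRing R] (N : ModuleCat.{u} R)
    (hN : IsIdealTorsion 𝔞 N) (m : ℕ) (h : S (extModule N X (m + 1))) :
    S (extModule N (ModuleCat.of R (cocycles (gammaComplex 𝔞 I) m)) 1) := by
  let f := gammaCocyclesInclusion 𝔞 I m
  let g := (LinearMap.range f).mkQ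
  have hfg : Function.Exact f g := LinearMap.exact_map_mkQ_range f
  have hg : Function.Surjective g := Submodule.mkQ_surjective _
  have hf : Function.Injective f := gammaCocyclesInclusion_injective 𝔞 I m
  refine prop_ext_left S (ModuleCat.shortComplex_shortExact
    (ModuleCat.shortComplexOfCompEqZero f g hfg.linearMap_comp_eq_zero) hfg hf hg) N ?_
    (prop_ext_cocycles I S N 0 m h)
  refine (prop_hom_iff S N (ModuleCat.of R (cocycles I.cocomplex m ⧸ LinearMap.range f))).1 ?_
  have : Subsingleton (N →ₗ[R] (cocycles I.cocomplex m ⧸ LinearMap.range f)) := by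
    refine subsingleton_of_forall_eq 0 (eq_zero_of_isIdealTorsion hN
      ((isIdealTorsion_gammaComplex 𝔞 I m).of_injective (Submodule.subtype _)
        (Submodule.injective_subtype _)) hfg hg ?_)
    rintro b ⟨k, hk⟩
    refine (hfg b).2 ⟨⟨⟨b.1, k, fun r hr => congrArg Subtype.val (hk r hr)⟩, ?_⟩, rfl⟩
    exact Subtype.ext b.2
  exact prop_of_subsingleton S (ModuleCat.of R (N →ₗ[R] (cocycles I.cocomplex m ⧸ _)))

variable {𝔞} in
/-- The image of `Hom(N, Zⁿ⁺¹) → Hom(N, Hⁿ⁺¹)` is a subquotient of `Extⁿ⁺¹(N, X)`, where `Z`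
denotes the cocycles of `Γ_𝔞(I)`. -/
theorem prop_range_hom_cocycles (N : ModuleCat.{u} R) (hN : IsIdealTorsion 𝔞 N) (n : ℕ)
    (h : S (extModule N X (n + 1))) {H : ModuleCat.{u} R}
    (π : cocycles (gammaComplex 𝔞 I) (n + 1) →ₗ[R] H)
    (hπ : ∀ z, z.1 ∈ coboundaries (gammaComplex 𝔞 I) (n + 1) → π z = 0) :
    S (ModuleCat.of R (LinearMap.range (LinearMap.compRight R (M := N) π))) := by
  have h₁ := prop_ext_cocycles I S N 0 n h
  let d := (I.cocomplex.d n (n + 1)).hom.rangeRestrict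
  have hT := LinearMap.shortExact_shortComplexKer (f := d) (LinearMap.surjective_rangeRestrict _)
  rw [cocycles, ← LinearMap.ker_rangeRestrict] at h₁
  let j : cocycles (gammaComplex 𝔞 I) (n + 1) →ₗ[R]
      LinearMap.range (I.cocomplex.d n (n + 1)).hom :=
    Submodule.inclusion (cocycles_succ_eq_coboundaries I n).ge ∘ₗ
      gammaCocyclesInclusion 𝔞 I (n + 1)
  let e : (N →ₗ[R] LinearMap.range (I.cocomplex.d n (n + 1)).hom) ≃ₗ[R]
      Ext N (ModuleCat.of R (LinearMap.range (I.cocomplex.d n (n + 1)).hom)) 0 :=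
    (Ext.linearEquiv₀.trans ModuleCat.homLinearEquiv).symm
  let δ := hT.extClass.postcompOfLinear R N (zero_add 1)
  refine prop_range_of_ker_le S
    (P := ModuleCat.of R (N →ₗ[R] cocycles (gammaComplex 𝔞 I) (n + 1)))
    (A := extModule N (ModuleCat.of R (LinearMap.ker d)) 1)
    (B := ModuleCat.of R (N →ₗ[R] H))
    (δ ∘ₗ e.toLinearMap ∘ₗ LinearMap.compRight R (M := N) j)
    (LinearMap.compRight R (M := N) π) ?_ h₁
  intro φ hφ
  -- If the connecting map kills `j ∘ₗ φ`, it lifts to `ψ : N → Iⁿ`. As `N` is torsion, `ψ` lands in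
  -- `Γ_𝔞(Iⁿ)`, so `φ` takes values in the coboundaries of `Γ_𝔞(I)`.
  obtain ⟨y, hy⟩ := Ext.covariant_sequence_exact₃ N hT (e (j ∘ₗ φ)) (zero_add 1) hφ
  obtain ⟨ψ, rfl⟩ := (Ext.linearEquiv₀ (R := R)).symm.surjective y
  have hψ : ∀ x, d (ψ.hom x) = j (φ x) := by
    intro x
    have h : ψ ≫ ModuleCat.ofHom d = ModuleCat.ofHom (j ∘ₗ φ) := by
      refine (Ext.mk₀_bijective _ _).1 ((Ext.mk₀_comp_mk₀ _ _).symm.trans hy)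
    exact congrArg (fun t => t.hom x) h
  ext x
  refine hπ (φ x) ⟨⟨ψ.hom x, map_mem_Gamma 𝔞 ψ.hom x (hN.mem x)⟩, Subtype.ext ?_⟩
  exact congrArg (fun z : LinearMap.range (I.cocomplex.d n (n + 1)).hom => z.1) (hψ x)

end Resolution

/-! ### Local cohomology through cocycles and coboundaries -/

section Resolution

variable {𝔞 : Ideal R} {X : ModuleCat.{u} R} (I : InjectiveResolution X)

/-- `0 → Bⁿ → Zⁿ → Hⁿ_𝔞(X) → 0`, where `B` and `Z` are the coboundaries and cocycles of
`Γ_𝔞(I)`. -/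
theorem exists_cocycles_to_localCohom (n : ℕ) :
    ∃ π : cocycles (gammaComplex 𝔞 I) n →ₗ[R] localCohom 𝔞 n X, Function.Surjective π ∧
      Function.Exact
        (Submodule.inclusion (coboundaries_le_cocycles (gammaComplex 𝔞 I) n)) π := by
  obtain ⟨π, hπ, h⟩ := exists_cocycles_to_homology (gammaComplex 𝔞 I) n
  let e : (gammaComplex 𝔞 I).homology n ≃ₗ[R] localCohom 𝔞 n X :=
    (I.isoRightDerivedObj (gammaFunctor 𝔞) n).symm.toLinearEquiv
  refine ⟨e.toLinearMap ∘ₗ π, e.surjective.comp hπ, fun z => ?_⟩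
  refine (e.map_eq_zero_iff.trans (h z)).trans ⟨fun hz => ⟨⟨z.1, hz⟩, rfl⟩, ?_⟩
  rintro ⟨y, rfl⟩
  exact y.2

theorem exists_shortExact_localCohom (n : ℕ) :
    ∃ T : ShortComplex (ModuleCat.{u} R), T.ShortExact ∧
      T.X₁ = ModuleCat.of R (coboundaries (gammaComplex 𝔞 I) n) ∧
      T.X₂ = ModuleCat.of R (cocycles (gammaComplex 𝔞 I) n) ∧ T.X₃ = localCohom 𝔞 n X := by
  obtain ⟨π, hπ, hf⟩ := exists_cocycles_to_localCohom (𝔞 := 𝔞) I n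
  exact ⟨ModuleCat.shortComplexOfCompEqZero _ π hf.linearMap_comp_eq_zero,
    ModuleCat.shortComplex_shortExact _ hf
      (Submodule.inclusion_injective (coboundaries_le_cocycles _ _)) hπ, rfl, rfl, rfl⟩

variable (S : ObjectProperty (ModuleCat.{u} R)) [S.IsSerreClass] (N : ModuleCat.{u} R)

theorem prop_ext_coboundaries_succ_iff [IsNoetherianRing R] (n p : ℕ) :
    S (extModule N (ModuleCat.of R (coboundaries (gammaComplex 𝔞 I) (n + 1))) (p + 1)) ↔
      S (extModule N (ModuleCat.of R (cocycles (gammaComplex 𝔞 I) n)) (p + 2)) := by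
  obtain ⟨T, hT, h₁, h₂, h₃⟩ := exists_shortExact_cocycles (gammaComplex 𝔞 I) n
  have : Injective T.X₂ := h₂ ▸ injective_gammaComplex 𝔞 I n
  rw [← h₁, ← h₃]
  exact prop_ext_iff_of_injective_middle S hT N p

/-- Induction from `B⁰ = 0`: a dimension shift passes from `Bⁿ⁺¹` to `Zⁿ`, an extension of `Hⁿ` by
`Bⁿ`. -/
theorem prop_ext_coboundaries [IsNoetherianRing R] (n : ℕ)
    (h : ∀ i < n, ∀ p, S (extModule N (localCohom 𝔞 i X) p)) (p : ℕ) :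
    S (extModule N (ModuleCat.of R (coboundaries (gammaComplex 𝔞 I) n)) (p + 1)) := by
  induction n generalizing p with
  | zero =>
    rw [coboundaries_zero]
    have : Injective (ModuleCat.of R (⊥ : Submodule R ((gammaComplex 𝔞 I).X 0))) :=
      (ModuleCat.isZero_of_subsingleton _).injective
    exact prop_ext_of_injective S N _ p
  | succ n ih =>
    rw [prop_ext_coboundaries_succ_iff I S N]
    have hB := ih (fun i hi => h i (hi.trans n.lt_succ_self)) (p + 1)
    have hH := h n n.lt_succ_self (p + 2)
    obtain ⟨T, hT, h₁, h₂, h₃⟩ := exists_shortExact_localCohom (𝔞 := 𝔞) I n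
    rw [← h₁] at hB
    rw [← h₃] at hH
    rw [← h₂]
    exact prop_ext_middle S hT N hB hH

theorem prop_ext_localCohom_iff_cocycles [IsNoetherianRing R] (n : ℕ)
    (h : ∀ i < n, ∀ p, S (extModule N (localCohom 𝔞 i X) p)) (p : ℕ) :
    S (extModule N (localCohom 𝔞 n X) (p + 1)) ↔
      S (extModule N (ModuleCat.of R (cocycles (gammaComplex 𝔞 I) n)) (p + 1)) := by
  have hB := prop_ext_coboundaries I S N n h
  obtain ⟨T, hT, h₁, h₂, h₃⟩ := exists_shortExact_localCohom (𝔞 := 𝔞) I n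
  rw [← h₁] at hB
  rw [← h₂, ← h₃]
  exact ⟨prop_ext_middle S hT N (hB p), fun h => prop_ext_right S hT N h (hB (p + 1))⟩

/-- If `Extⁿ⁺¹(N, X)` and `Extⁿ⁺²(N, X)` lie in `𝒮`, then `Hom(N, Hⁿ⁺¹_𝔞(X)) ∈ 𝒮` if and only if
`Ext¹(N, Bⁿ⁺¹) ∈ 𝒮`, where `B` denotes the coboundaries of `Γ_𝔞(I)`. -/
theorem prop_ext_localCohom_succ_zero_iff_coboundaries [IsNoetherianRing R]
    (hN : IsIdealTorsion 𝔞 N) (n : ℕ) (hExt₁ : S (extModule N X (n + 1)))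
    (hExt₂ : S (extModule N X (n + 2))) :
    S (extModule N (localCohom 𝔞 (n + 1) X) 0) ↔
      S (extModule N (ModuleCat.of R (coboundaries (gammaComplex 𝔞 I) (n + 1))) 1) := by
  obtain ⟨π, hπ, hf⟩ := exists_cocycles_to_localCohom (𝔞 := 𝔞) I (n + 1)
  have hT := ModuleCat.shortComplex_shortExact
    (ModuleCat.shortComplexOfCompEqZero _ π hf.linearMap_comp_eq_zero) hf
    (Submodule.inclusion_injective (coboundaries_le_cocycles _ _)) hπ
  refine ⟨fun hH => prop_ext_left S hT N hH (prop_ext_gammaCocycles I S N hN (n + 1) hExt₂),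
    fun hB => ?_⟩
  have hr := prop_range_hom_cocycles I S N hN n hExt₁ π fun z hz => (hf z).2 ⟨⟨z.1, hz⟩, rfl⟩
  let e : Ext N (localCohom 𝔞 (n + 1) X) 0 ≃ₗ[R] (N →ₗ[R] localCohom 𝔞 (n + 1) X) :=
    Ext.linearEquiv₀.trans ModuleCat.homLinearEquiv
  -- The kernel of `Hom(N, Hⁿ⁺¹) → Ext¹(N, Bⁿ⁺¹)` is the image of `Hom(N, Zⁿ⁺¹)`, already in `𝒮` by
  -- `hr`.
  refine prop_of_exact S
    (A := ModuleCat.of R (LinearMap.range (LinearMap.compRight R (M := N) π)))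
    (B := extModule N (localCohom 𝔞 (n + 1) X) 0)
    (C := extModule N (ModuleCat.of R (coboundaries (gammaComplex 𝔞 I) (n + 1))) 1)
    (e.symm.toLinearMap ∘ₗ Submodule.subtype _)
    (hT.extClass.postcompOfLinear R N (zero_add 1)) (fun x => ⟨fun hx => ?_, ?_⟩) hr hB
  · obtain ⟨y, hy⟩ := Ext.covariant_sequence_exact₃ N hT x (zero_add 1) hx
    obtain ⟨ψ, rfl⟩ := (Ext.linearEquiv₀ (R := R)).symm.surjective y
    exact ⟨⟨_, ψ.hom, rfl⟩, (Ext.mk₀_comp_mk₀ _ _).symm.trans hy⟩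
  · rintro ⟨⟨_, ψ, rfl⟩, rfl⟩
    change (Ext.mk₀ (ModuleCat.ofHom (π ∘ₗ ψ))).comp hT.extClass (zero_add 1) = 0
    rw [ModuleCat.ofHom_comp, ← Ext.mk₀_comp_mk₀]
    refine (Ext.comp_assoc_of_second_deg_zero _ (Ext.mk₀ (ModuleCat.ofHom π)) hT.extClass
      (zero_add 1)).trans ?_
    refine (congrArg (fun t => (Ext.mk₀ (ModuleCat.ofHom ψ)).comp t (zero_add 1))
      hT.comp_extClass).trans ?_
    exact Ext.comp_zero (Ext.mk₀ (ModuleCat.ofHom ψ)) _ 1 1 (zero_add 1)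

end Resolution

end SerreCofinite

theorem theorem4p6 {R : Type u} [CommRing R] [IsNoetherianRing R] (𝔞 : Ideal R)
    (S : ObjectProperty (ModuleCat.{u} R)) [S.IsSerreClass]
    (N : ModuleCat.{u} R) [Module.Finite R N] (hN : SerreCofinite.IsIdealTorsion 𝔞 N)
    (X : ModuleCat.{u} R) (n : ℕ)
    (hExt₁ : S (SerreCofinite.extModule N X (n + 1)))
    (hExt₂ : S (SerreCofinite.extModule N X (n + 2)))
    (hcof : ∀ i : ℕ, i < n → SerreCofinite.IsCofinite S 𝔞 (SerreCofinite.localCohom 𝔞 i X)) :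
    S (ModuleCat.of R (N →ₗ[R] SerreCofinite.localCohom 𝔞 (n + 1) X)) ↔
      S (SerreCofinite.extModule N (SerreCofinite.localCohom 𝔞 n X) 2) := by
  have h : ∀ i < n, ∀ p, S (SerreCofinite.extModule N (SerreCofinite.localCohom 𝔞 i X) p) :=
    fun i hi p => SerreCofinite.prop_ext_of_isIdealTorsion S _ (hcof i hi).2 p N hN
  let I : InjectiveResolution X := (inferInstance : HasInjectiveResolution X).out.some
  -- Chain: `Hom(N, Hⁿ⁺¹)`, `Ext¹(N, Bⁿ⁺¹)`, `Ext²(N, Zⁿ)`, `Ext²(N, Hⁿ)`.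
  rw [SerreCofinite.prop_hom_iff S,
    SerreCofinite.prop_ext_localCohom_succ_zero_iff_coboundaries I S N hN n hExt₁ hExt₂,
    SerreCofinite.prop_ext_coboundaries_succ_iff I S N,
    SerreCofinite.prop_ext_localCohom_iff_cocycles I S N n h 1]
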